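/- All matrices are complex. For $n\times n$ matrices $A,B$ let $X_A$ and $\Delta_B$ be the endomorphisms $X_A(M)=AM$ and $\Delta_B(M)=B\circ M$ (entrywise product) of $\mathrm{Mat}_n(\mathbb C)$. The pair $(A,B)$ is a one-sided Jones pair if $X_A$ and $\Delta_B$ are invertible and $X_A\Delta_BX_A=\Delta_BX_A\Delta_B$; it is a Jones pair if both $(A,B)$ and $(A,B^T)$ are one-sided Jones pairs, and it is an invertible Jones pair if in addition $A$ has no zero entry and $B$ is an invertible matrix. Let $\mathcal N_{A,B}$ be the space of all $n\times n$ matrices $M$ such that each of the vectors $Ae_i\circ Be_j$ $(1\le i,j\le n)$ is an eigenvector of $M$; the dimension of a Jones pair $(A,B)$ is $\dim\mathcal N_{A,B}$. A symmetric $(n,k,\lambda)$-design consists of $n$ points and $n$ blocks, with $0<k<n$, such that each block contains exactly $k$ points, each point lies on exactly $k$ blocks, and any two distinct points lie together on exactly $\lambda$ blocks (so the trivial designs with $k=1$ or $k=n-1$ are allowed). Its incidence matrix is the $n\times n$ $01$-matrix with rows indexed by points and columns by blocks. Lemma. If $(A,B)$ is an $n\times n$ invertible Jones pair of dimension two, then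 there are scalars $a,b\in\mathbb C$ and the incidence matrix $N$ of a symmetric $(n,k,\lambda)$-design, for some integers $k,\lambda\ge 0$, such that $$B=a(J-N)+bN,$$ where $J$ is the $n\times n$ all-ones matrix. -/

import Mathlib

open Matrix

namespace JonesPair

variable {n : ℕ}

/-- The endomorphism `X_A : M ↦ A M` of `Mat_n(ℂ)`. -/
def X (A : Matrix (Fin n) (Fin n) ℂ) : Module.End ℂ (Matrix (Fin n) (Fin n) ℂ) where
  toFun M := A * M
  map_add' M M' := Matrix.mul_add A M M'
  map_smul' c M := by simp

/-- The endomorphism `Δ_B : M ↦ B ∘ M` (entrywise product) of `Mat_n(ℂ)`. -/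
def Delta (B : Matrix (Fin n) (Fin n) ℂ) : Module.End ℂ (Matrix (Fin n) (Fin n) ℂ) where
  toFun M := B ⊙ M
  map_add' M M' := Matrix.hadamard_add B M M'
  map_smul' c M := by simp

/-- `(A, B)` is a one-sided Jones pair: `X_A` and `Δ_B` are invertible and
`X_A Δ_B X_A = Δ_B X_A Δ_B`. -/
def IsOneSidedJonesPair (A B : Matrix (Fin n) (Fin n) ℂ) : Prop :=
  IsUnit (X A) ∧ IsUnit (Delta B) ∧ X A * Delta B * X A = Delta B * X A * Delta B

/-- `(A, B)` is a Jones pair: both `(A, B)` and `(A, Bᵀ)` are one-sided Jones pairs. -/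
def IsJonesPair (A B : Matrix (Fin n) (Fin n) ℂ) : Prop :=
  IsOneSidedJonesPair A B ∧ IsOneSidedJonesPair A Bᵀ

/-- A Jones pair `(A, B)` is invertible if `A` is Schur-invertible (has no zero entry) and `B` is
an invertible matrix. -/
def IsInvertibleJonesPair (A B : Matrix (Fin n) (Fin n) ℂ) : Prop :=
  IsJonesPair A B ∧ (∀ i j, A i j ≠ 0) ∧ IsUnit B

/-- The vector `A e_i ∘ B e_j`: the entrywise product of column `i` of `A` and column `j` of `B`. -/
def colProd (A B : Matrix (Fin n) (Fin n) ℂ) (i j : Fin n) : Fin n → ℂ :=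
  fun r => A r i * B r j

/-- `N_{A,B}`: the space of matrices `M` that have every `A e_i ∘ B e_j` as an eigenvector.
(For a Jones pair all these vectors are nonzero, as `A` is invertible and `B` has no zero entry.) -/
def nomura (A B : Matrix (Fin n) (Fin n) ℂ) : Submodule ℂ (Matrix (Fin n) (Fin n) ℂ) where
  carrier := {M | ∀ i j, ∃ θ : ℂ, M *ᵥ colProd A B i j = θ • colProd A B i j}
  zero_mem' := fun i j => ⟨0, by simp⟩
  add_mem' := by
    intro M M' hM hM' i j
    obtain ⟨θ, h⟩ := hM i j
    obtain ⟨θ', h'⟩ := hM' i j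
    exact ⟨θ + θ', by rw [Matrix.add_mulVec, h, h', add_smul]⟩
  smul_mem' := by
    intro c M hM i j
    obtain ⟨θ, h⟩ := hM i j
    exact ⟨c * θ, by rw [Matrix.smul_mulVec, h, smul_smul]⟩

/-- The dimension of a Jones pair `(A, B)` is `dim N_{A,B}`. -/
noncomputable def dimension (A B : Matrix (Fin n) (Fin n) ℂ) : ℕ :=
  Module.finrank ℂ (nomura A B)

/-- A symmetric `(v, k, lam)`-design with point set `P` and block set `Q`: there are `v` points and
`v` blocks, every block contains exactly `k` points and every point lies on exactly `k` blocks with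
`0 < k < v`, and any two distinct points lie together on exactly `lam` blocks.
The trivial designs with `k = 1` or `k = v - 1` are included. -/
structure SymmetricDesign (P Q : Type*) (v k lam : ℕ) where
  inc : P → Q → Prop
  card_points : Nat.card P = v
  card_blocks : Nat.card Q = v
  pos : 0 < k
  lt : k < v
  block_size : ∀ q, {p | inc p q}.ncard = k
  replication : ∀ p, {q | inc p q}.ncard = k
  balance : ∀ p p', p ≠ p' → {q | inc p q ∧ inc p' q}.ncard = lam

open Classical in
/-- The incidence matrix: rows are points, columns are blocks. -/
noncomputable def SymmetricDesign.incMatrix {P Q : Type*} {v k lam : ℕ}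
    (D : SymmetricDesign P Q v k lam) : Matrix P Q ℂ :=
  Matrix.of fun p q => if D.inc p q then 1 else 0

/-- The all-ones matrix `J`. -/
def allOnes (n : ℕ) : Matrix (Fin n) (Fin n) ℂ :=
  Matrix.of fun _ _ => 1

end JonesPair

/-!
Compared on columns, `X_A Δ_B X_A = Δ_B X_A Δ_B` is the braid relation `A D A = D A D` between `A`
and each diagonal matrix `D = D_j` of a column of `B`. Hence `A D_j A⁻¹ = D_j⁻¹ A D_j` has the
diagonal of `A`: taking traces, every column of `B` sums to `tr A`, and comparing entries, the
invertibility of `B` forces `A i j * A⁻¹ j i` to be constant, so that `A` is a type II matrix. The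
braid relations for two columns combine to `S D_j = D_i S` with `S = A⁻¹ D_i⁻¹ D_j A`, whose
diagonal is constant since `A` is type II; as `D_i ≠ D_j`, this constant `n⁻¹ ∑ r, B r j / B r i`
vanishes, so `B` is type II as well.

The entries of `B` are the eigenvalues of `A` on the vectors `A e_i ∘ B e_j`. So `A` lies in the
algebra `N_{A,B}`, and the number of values of `B` is at most the degree of the minimal polynomial
of `A`, hence at most two. For a two-valued type II matrix the identity `a b x⁻¹ = a + b - x`
on `{a, b}` turns the orthogonality of `B` and its entrywise inverse into constant row sums and
constant inner products of distinct rows, that is, into a symmetric design.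
-/

namespace JonesPair

section TypeII

variable {ι K : Type*} [Fintype ι] [DecidableEq ι] [Field K]

/-- Type II matrices: those `W` without zero entries whose entrywise inverse `W⁽⁻⁾` satisfies
`W (W⁽⁻⁾)ᵀ = |ι| I`. -/
structure IsTypeII (W : Matrix ι ι K) : Prop where
  ne_zero : ∀ i j, W i j ≠ 0
  mul_transpose_map_inv : W * (W.map (·⁻¹))ᵀ = (Fintype.card ι : K) • 1

lemma IsTypeII.sum_mul_inv {W : Matrix ι ι K} (hW : IsTypeII W) (i j : ι) :
    ∑ r, W i r * (W j r)⁻¹ = if i = j then (Fintype.card ι : K) else 0 := by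
  simpa [Matrix.mul_apply, Matrix.one_apply] using congrFun₂ hW.mul_transpose_map_inv i j

variable [CharZero K]

lemma isTypeII_iff_mul_inv_apply {W : Matrix ι ι K} :
    IsTypeII W ↔ IsUnit W ∧ ∀ i j, W i j * W⁻¹ j i = (Fintype.card ι : K)⁻¹ := by
  have hcard (i : ι) : (Fintype.card ι : K) ≠ 0 :=
    Nat.cast_ne_zero.2 (Fintype.card_pos_iff.2 ⟨i⟩).ne'
  constructor
  · intro hW
    have hmul : W * ((Fintype.card ι : K)⁻¹ • (W.map (·⁻¹))ᵀ) = 1 := by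
      ext i j
      rw [Matrix.mul_smul, hW.mul_transpose_map_inv, inv_smul_smul₀ (hcard i)]
    refine ⟨IsUnit.of_mul_eq_one _ hmul, fun i j => ?_⟩
    have := hW.ne_zero i j
    simp [Matrix.inv_eq_right_inv hmul, field]
  · rintro ⟨hW, hinv⟩
    have hne (i j) : W i j ≠ 0 :=
      left_ne_zero_of_mul (hinv i j ▸ inv_ne_zero (hcard i))
    refine ⟨hne, ?_⟩
    have hmap : (W.map (·⁻¹))ᵀ = (Fintype.card ι : K) • W⁻¹ := by
      ext j i
      have := hne i j
      have := hcard i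
      simp [eq_div_of_mul_eq (hne i j) ((mul_comm _ _).trans (hinv i j)), field]
    rw [hmap, Matrix.mul_smul, Matrix.mul_nonsing_inv _ ((Matrix.isUnit_iff_isUnit_det _).1 hW)]

lemma IsTypeII.of_transpose {W : Matrix ι ι K} (hW : IsTypeII Wᵀ) : IsTypeII W := by
  rw [isTypeII_iff_mul_inv_apply] at hW ⊢
  refine ⟨(Matrix.isUnit_transpose _).1 hW.1, fun i j => ?_⟩
  simpa [← Matrix.transpose_nonsing_inv] using hW.2 j i

lemma IsTypeII.inv_mul_diagonal_mul_apply_self {W : Matrix ι ι K} (hW : IsTypeII W) (v : ι → K)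
    (i : ι) : (W⁻¹ * diagonal v * W) i i = (Fintype.card ι : K)⁻¹ * ∑ r, v r := by
  rw [Matrix.mul_apply, Finset.mul_sum]
  refine Finset.sum_congr rfl fun r _ => ?_
  rw [Matrix.mul_diagonal, ← (isTypeII_iff_mul_inv_apply.1 hW).2 r i]
  ring

end TypeII

section Braid

lemma semiconjBy_of_braid {M : Type*} [Semigroup M] {a d : M} (h : a * d * a = d * a * d) :
    SemiconjBy (d * a) d a := by
  rw [SemiconjBy, ← h, mul_assoc]

lemma semiconjBy_conj_of_braid {M : Type*} [Monoid M] {a d : Mˣ} {e : M}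
    (hd : (a * d * a : M) = d * a * d) (he : a * e * a = e * a * e) :
    SemiconjBy (↑a⁻¹ * (↑d⁻¹ * e) * ↑a) e d := by
  have hda : SemiconjBy (↑(d * a)⁻¹ : M) a d :=
    SemiconjBy.units_inv_symm_left (semiconjBy_of_braid hd)
  simpa [mul_assoc] using hda.mul_left (semiconjBy_of_braid he)

variable {ι K : Type*} [Fintype ι] [DecidableEq ι] [Field K]

/-- The matrix form, over an arbitrary field, of the relation defining a one-sided Jones pair:
compared on the columns of a matrix, `X_A Δ_B X_A = Δ_B X_A Δ_B` is the braid relation between `A`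
and the diagonal matrix of each column of `B`. -/
structure IsBraidPair (A B : Matrix ι ι K) : Prop where
  isUnit : IsUnit A
  ne_zero : ∀ i j, B i j ≠ 0
  braid : ∀ j, A * diagonal (B.col j) * A = diagonal (B.col j) * A * diagonal (B.col j)

namespace IsBraidPair

variable {A B : Matrix ι ι K} (h : IsBraidPair A B)
include h

lemma isUnit_diagonal_col (j : ι) : IsUnit (diagonal (B.col j)) :=
  Matrix.isUnit_diagonal.2 (Pi.isUnit_iff.2 fun i => (h.ne_zero i j).isUnit)

lemma diag_conj_diagonal_col (j : ι) : (A * diagonal (B.col j) * A⁻¹).diag = A.diag := by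
  have hconj : diagonal (B.col j) * (A * diagonal (B.col j) * A⁻¹) = A * diagonal (B.col j) := by
    rw [← mul_assoc, ← mul_assoc, ← h.braid,
      Matrix.mul_nonsing_inv_cancel_right _ _ ((Matrix.isUnit_iff_isUnit_det _).1 h.isUnit)]
  ext i
  have hentry := congrFun₂ hconj i i
  rw [Matrix.diagonal_mul, Matrix.mul_diagonal, mul_comm] at hentry
  exact mul_right_cancel₀ (h.ne_zero i j) hentry

lemma sum_col (j : ι) : ∑ i, B i j = A.trace := by
  calc ∑ i, B i j = (A * diagonal (B.col j) * A⁻¹).trace := by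
        rw [Matrix.trace_conj h.isUnit, Matrix.trace_diagonal]; rfl
    _ = A.trace := by rw [Matrix.trace, h.diag_conj_diagonal_col, Matrix.trace]

variable (hB : IsUnit B)
include hB

lemma trace_ne_zero [Nonempty ι] : A.trace ≠ 0 := by
  intro htrace
  refine one_ne_zero (Matrix.vecMul_injective_of_isUnit hB (a₁ := 1) (a₂ := 0) ?_)
  ext j
  simpa [Matrix.vecMul, dotProduct] using (h.sum_col j).trans htrace

lemma trace_mul_mul_inv_apply (i j : ι) : A.trace * (A i j * A⁻¹ j i) = A i i := by
  have hvec : A.trace • (fun r => A i r * A⁻¹ r i) = fun _ => A i i := by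
    refine Matrix.vecMul_injective_of_isUnit hB (funext fun j => ?_)
    have hdiag := congrFun (h.diag_conj_diagonal_col j) i
    rw [Matrix.diag_apply, Matrix.diag_apply, Matrix.mul_apply] at hdiag
    simp only [Matrix.mul_diagonal, Matrix.col_apply] at hdiag
    calc ((A.trace • fun r => A i r * A⁻¹ r i) ᵥ* B) j
        = A.trace * ∑ r, A i r * B r j * A⁻¹ r i := by
          rw [Matrix.smul_vecMul]
          simp only [Pi.smul_apply, smul_eq_mul, Matrix.vecMul, dotProduct, mul_right_comm]
      _ = ((fun _ => A i i) ᵥ* B) j := by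
          rw [hdiag, ← h.sum_col j, Finset.sum_mul]
          simp only [Matrix.vecMul, dotProduct, mul_comm]
  exact congrFun hvec j

variable [CharZero K]

theorem isTypeII_left : IsTypeII A := by
  refine isTypeII_iff_mul_inv_apply.2 ⟨h.isUnit, fun i j => ?_⟩
  have : Nonempty ι := ⟨i⟩
  have htrace : A.trace = Fintype.card ι * A i i := by
    calc A.trace = A.trace * ∑ r, A i r * A⁻¹ r i := by
          rw [← Matrix.mul_apply,
            Matrix.mul_nonsing_inv _ ((Matrix.isUnit_iff_isUnit_det _).1 h.isUnit)]
          simp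
      _ = Fintype.card ι * A i i := by
          simp [Finset.mul_sum, h.trace_mul_mul_inv_apply hB i]
  refine mul_left_cancel₀ (h.trace_ne_zero hB) ?_
  rw [h.trace_mul_mul_inv_apply hB, htrace]
  simp [field]

lemma sum_col_mul_inv_col_eq_zero {i j : ι} (hij : i ≠ j) : ∑ r, B r j * (B r i)⁻¹ = 0 := by
  by_contra hsum
  obtain ⟨a, ha⟩ := h.isUnit
  obtain ⟨d, hd⟩ := h.isUnit_diagonal_col i
  have hquot : (↑d⁻¹ : Matrix ι ι K) * diagonal (B.col j) =
      diagonal fun r => B r j * (B r i)⁻¹ := by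
    rw [Units.inv_mul_eq_iff_eq_mul, hd, Matrix.diagonal_mul_diagonal]
    congr! 2 with r
    have := h.ne_zero r i
    simp [field]
  have hW := semiconjBy_conj_of_braid (ha ▸ hd ▸ h.braid i) (ha ▸ h.braid j)
  rw [hquot, hd, Matrix.coe_units_inv, ha] at hW
  have hcol (r) : B r i = B r j := by
    have hentry := congrFun₂ hW.eq r r
    rw [Matrix.mul_diagonal, Matrix.diagonal_mul, mul_comm,
      (h.isTypeII_left hB).inv_mul_diagonal_mul_apply_self] at hentry
    have : Nonempty ι := ⟨r⟩
    exact (mul_right_cancel₀ (mul_ne_zero (by simp) hsum) hentry).symm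
  exact ((Matrix.isUnit_iff_isUnit_det _).1 hB).ne_zero (Matrix.det_zero_of_column_eq hij hcol)

theorem isTypeII_right : IsTypeII B := by
  refine IsTypeII.of_transpose ⟨fun i j => h.ne_zero j i, ?_⟩
  ext j i
  rcases eq_or_ne i j with rfl | hij
  · simp [Matrix.mul_apply, h.ne_zero]
  · simpa [Matrix.mul_apply, hij.symm] using h.sum_col_mul_inv_col_eq_zero hB hij

end IsBraidPair

end Braid

section Design

section TwoValued

variable {ι R : Type*} [Fintype ι] [CommRing R] {a b : R} {f g : ι → R}

lemma sum_sub_eq_ncard_mul (hf : ∀ i, f i = a ∨ f i = b) :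
    ∑ i, (f i - a) = {i | f i = b}.ncard * (b - a) := by
  classical
  have hterm (i) : f i - a = if f i = b then b - a else 0 := by grind
  simp only [hterm, Finset.sum_ite, Finset.sum_const, smul_zero, add_zero,
    Set.ncard_eq_toFinset_card', Set.toFinset_ofPred, nsmul_eq_mul]

lemma sum_sub_mul_sub_eq_ncard_mul (hf : ∀ i, f i = a ∨ f i = b) (hg : ∀ i, g i = a ∨ g i = b) :
    ∑ i, (f i - a) * (g i - a) = {i | f i = b ∧ g i = b}.ncard * (b - a) ^ 2 := by
  classical
  have hterm (i) : (f i - a) * (g i - a) = if f i = b ∧ g i = b then (b - a) ^ 2 else 0 := by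
    grind
  simp only [hterm, Finset.sum_ite, Finset.sum_const, smul_zero, add_zero,
    Set.ncard_eq_toFinset_card', Set.toFinset_ofPred, nsmul_eq_mul]

variable [IsDomain R] [CharZero R]

lemma ncard_eq_of_sum_eq (hab : a ≠ b) (hf : ∀ i, f i = a ∨ f i = b)
    (hg : ∀ i, g i = a ∨ g i = b) (hsum : ∑ i, f i = ∑ i, g i) :
    {i | f i = b}.ncard = {i | g i = b}.ncard := by
  have hcount : ∑ i, (f i - a) = ∑ i, (g i - a) := by
    simp only [Finset.sum_sub_distrib, hsum]
  rw [sum_sub_eq_ncard_mul hf, sum_sub_eq_ncard_mul hg] at hcount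
  exact_mod_cast mul_right_cancel₀ (sub_ne_zero.2 hab.symm) hcount

end TwoValued

variable {ι K : Type*} [Fintype ι] [DecidableEq ι] [Field K]

lemma exists_apply_ne_of_isUnit [Nontrivial ι] {W : Matrix ι ι K} (hW : IsUnit W) (c : K) :
    ∃ i j, W i j ≠ c := by
  by_contra! hconst
  obtain ⟨i, i', hii'⟩ := exists_pair_ne ι
  exact ((Matrix.isUnit_iff_isUnit_det _).1 hW).ne_zero
    (Matrix.det_zero_of_row_eq hii' (funext fun j => by rw [hconst, hconst]))

namespace IsTypeII

variable {W : Matrix ι ι K} {a b t : K} (hW : IsTypeII W)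
include hW

lemma mul_sum_row_inv (hcol : ∀ j, ∑ i, W i j = t) (i : ι) :
    t * ∑ j, (W i j)⁻¹ = Fintype.card ι := by
  calc t * ∑ j, (W i j)⁻¹ = ∑ i', ∑ j, W i' j * (W i j)⁻¹ := by
        rw [Finset.sum_comm, Finset.mul_sum]
        simp only [← Finset.sum_mul, hcol]
    _ = Fintype.card ι := by simp [hW.sum_mul_inv]

variable (hval : ∀ i j, W i j = a ∨ W i j = b)
include hval

lemma mul_inv_apply_of_two_valued (i j : ι) : a * b * (W i j)⁻¹ = a + b - W i j := by
  have hne := hW.ne_zero i j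
  rcases hval i j with h | h <;> rw [h] at hne ⊢ <;> field_simp <;> ring

variable [CharZero K] (hcol : ∀ j, ∑ i, W i j = t)
include hcol

lemma sum_row_of_two_valued (i : ι) : ∑ j, W i j = t := by
  have : Nonempty ι := ⟨i⟩
  have hcard : (Fintype.card ι : K) ≠ 0 := by simp
  have ht : t ≠ 0 := left_ne_zero_of_mul (hW.mul_sum_row_inv hcol i ▸ hcard)
  have hrow (i') : t * ∑ j, W i' j = t * (Fintype.card ι * (a + b)) - a * b * Fintype.card ι := by
    have hinv : a * b * ∑ j, (W i' j)⁻¹ = Fintype.card ι * (a + b) - ∑ j, W i' j := by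
      simp [Finset.mul_sum, hW.mul_inv_apply_of_two_valued hval, mul_add]
    linear_combination t * hinv - a * b * hW.mul_sum_row_inv hcol i'
  have hrow_eq (i') : ∑ j, W i' j = ∑ j, W i j :=
    mul_left_cancel₀ ht ((hrow i').trans (hrow i).symm)
  have htotal := Finset.sum_comm (s := .univ) (t := .univ) (f := fun i j => W i j)
  simp only [hrow_eq, hcol, Finset.sum_const, nsmul_eq_mul] at htotal
  exact mul_left_cancel₀ hcard htotal

lemma sum_row_mul_row_of_two_valued {i i' : ι} (hii' : i ≠ i') :
    ∑ j, W i j * W i' j = (a + b) * t := by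
  have horth : ∑ j, W i j * (a + b - W i' j) = 0 := by
    calc ∑ j, W i j * (a + b - W i' j) = a * b * ∑ j, W i j * (W i' j)⁻¹ := by
          simp only [← hW.mul_inv_apply_of_two_valued hval, Finset.mul_sum, mul_left_comm]
      _ = 0 := by rw [hW.sum_mul_inv, if_neg hii', mul_zero]
  simp only [mul_sub, Finset.sum_sub_distrib, ← Finset.sum_mul,
    hW.sum_row_of_two_valued hval hcol] at horth
  linear_combination -horth

lemma ncard_row_inter_row_mul {i i' : ι} (hii' : i ≠ i') :
    {j | W i j = b ∧ W i' j = b}.ncard * (b - a) ^ 2 = (b - a) * t + Fintype.card ι * a ^ 2 := by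
  rw [← sum_sub_mul_sub_eq_ncard_mul (hval i) (hval i')]
  calc ∑ j, (W i j - a) * (W i' j - a)
      = ∑ j, (W i j * W i' j - a * W i j - a * W i' j + a ^ 2) :=
        Finset.sum_congr rfl fun j _ => by ring
    _ = (b - a) * t + Fintype.card ι * a ^ 2 := by
        simp only [Finset.sum_add_distrib, Finset.sum_sub_distrib, ← Finset.mul_sum,
          hW.sum_row_mul_row_of_two_valued hval hcol hii', hW.sum_row_of_two_valued hval hcol,
          Finset.sum_const, Finset.card_univ, nsmul_eq_mul]
        ring

theorem exists_symmetricDesign [Nontrivial ι] (hab : a ≠ b) {v : ℕ} (hv : Nat.card ι = v) :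
    ∃ (k lam : ℕ) (D : SymmetricDesign ι ι v k lam), ∀ i j, D.inc i j ↔ W i j = b := by
  have hunit := (isTypeII_iff_mul_inv_apply.1 hW).1
  obtain ⟨p, q, hpq⟩ := exists_apply_ne_of_isUnit hunit a
  obtain ⟨r, s, hrs⟩ := exists_apply_ne_of_isUnit hunit b
  obtain ⟨x, x', hxx'⟩ := exists_pair_ne ι
  have hblock (j) : {i | W i j = b}.ncard = {i | W i q = b}.ncard :=
    ncard_eq_of_sum_eq hab (hval · j) (hval · q) ((hcol j).trans (hcol q).symm)
  have hlt : {i | W i s = b}.ncard < Nat.card ι :=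
    Set.ncard_lt_card ((Set.ne_univ_iff_exists_notMem _).2 ⟨r, hrs⟩)
  exact ⟨{i | W i q = b}.ncard, {j | W x j = b ∧ W x' j = b}.ncard,
    { inc := fun i j => W i j = b
      card_points := hv
      card_blocks := hv
      pos := (Set.ncard_pos).2 ⟨p, (hval p q).resolve_left hpq⟩
      lt := hv ▸ hblock s ▸ hlt
      block_size := hblock
      replication := fun i => ncard_eq_of_sum_eq hab (hval i) (hval · q)
        ((hW.sum_row_of_two_valued hval hcol i).trans (hcol q).symm)
      balance := fun y y' hyy' => by
        have hcount := (hW.ncard_row_inter_row_mul hval hcol hyy').trans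
          (hW.ncard_row_inter_row_mul hval hcol hxx').symm
        exact_mod_cast mul_right_cancel₀ (pow_ne_zero 2 (sub_ne_zero.2 hab.symm)) hcount },
    fun _ _ => Iff.rfl⟩

end IsTypeII

end Design

section JonesPair

variable {n : ℕ} {A B : Matrix (Fin n) (Fin n) ℂ}

lemma SymmetricDesign.eq_smul_add_smul_incMatrix {v k lam : ℕ}
    (D : SymmetricDesign (Fin n) (Fin n) v k lam) {a b : ℂ} (hval : ∀ i j, B i j = a ∨ B i j = b)
    (hinc : ∀ i j, D.inc i j ↔ B i j = b) :
    B = a • (allOnes n - D.incMatrix) + b • D.incMatrix := by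
  ext i j
  by_cases hij : B i j = b
  · simp [allOnes, incMatrix, hinc, hij]
  · simpa [allOnes, incMatrix, hinc, hij] using (hval i j).resolve_right hij

theorem IsOneSidedJonesPair.isBraidPair (h : IsOneSidedJonesPair A B) : IsBraidPair A B where
  isUnit := by
    obtain ⟨M, hM⟩ := ((Module.End.isUnit_iff _).1 h.1).surjective 1
    exact IsUnit.of_mul_eq_one M hM
  ne_zero i j hij := by
    have hzero : Delta B (Matrix.single i j 1) = Delta B 0 := by
      ext r s
      simp only [Delta, LinearMap.coe_mk, AddHom.coe_mk, Matrix.hadamard_apply,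
        Matrix.single_apply, Matrix.zero_apply]
      grind
    have := ((Module.End.isUnit_iff _).1 h.2.1).injective hzero
    simpa using congrFun₂ this i j
  braid j := by
    ext s i
    have := congrFun₂ (LinearMap.congr_fun h.2.2 (Matrix.replicateCol (Fin n) (Pi.single i 1))) s j
    simpa [X, Delta, Matrix.mul_apply, Matrix.diagonal_apply, Matrix.hadamard_apply,
      Pi.single_apply, mul_assoc] using this

lemma colProd_eq_col (i j : Fin n) : colProd A B i j = (diagonal (B.col j) * A).col i := by
  ext r
  simp [colProd, mul_comm]

namespace IsBraidPair

variable (h : IsBraidPair A B)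
include h

lemma mulVec_colProd (i j : Fin n) : A *ᵥ colProd A B i j = B i j • colProd A B i j := by
  ext s
  calc (A *ᵥ colProd A B i j) s = (A * (diagonal (B.col j) * A)) s i := by
        rw [colProd_eq_col]; rfl
    _ = (B i j • colProd A B i j) s := by
        rw [← mul_assoc, h.braid, Matrix.mul_diagonal, mul_comm, colProd_eq_col]; rfl

lemma colProd_ne_zero (i j : Fin n) : colProd A B i j ≠ 0 := by
  rw [colProd_eq_col]
  exact (Matrix.linearIndependent_cols_of_isUnit
    ((h.isUnit_diagonal_col j).mul h.isUnit)).ne_zero i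

end IsBraidPair

/-- The Nomura algebra: `N_{A,B}` is closed under products, since the vectors `A e_i ∘ B e_j` are
common eigenvectors of its elements. -/
def nomuraAlgebra (A B : Matrix (Fin n) (Fin n) ℂ) :
    Subalgebra ℂ (Matrix (Fin n) (Fin n) ℂ) :=
  (nomura A B).toSubalgebra (fun _ _ => ⟨1, by simp⟩) fun M M' hM hM' i j => by
    obtain ⟨θ, hθ⟩ := hM i j
    obtain ⟨θ', hθ'⟩ := hM' i j
    exact ⟨θ' * θ, by rw [← Matrix.mulVec_mulVec, hθ', Matrix.mulVec_smul, hθ, smul_smul]⟩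

lemma natDegree_minpoly_le_dimension {M : Matrix (Fin n) (Fin n) ℂ} (hM : M ∈ nomura A B) :
    (minpoly ℂ M).natDegree ≤ dimension A B := by
  let M' : nomuraAlgebra A B := ⟨M, hM⟩
  calc (minpoly ℂ M).natDegree = (minpoly ℂ M').natDegree := by
        rw [← minpoly.algHom_eq (nomuraAlgebra A B).val Subtype.val_injective M']; rfl
    _ ≤ dimension A B := minpoly.natDegree_le M'

theorem IsBraidPair.ncard_range_le_dimension (h : IsBraidPair A B) :
    (Set.range (Function.uncurry B)).ncard ≤ dimension A B := by
  have hroot (i j) : B i j ∈ (minpoly ℂ A).rootSet ℂ := by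
    have heigen : Module.End.HasEigenvector (Matrix.toLin' A) (B i j) (colProd A B i j) :=
      Module.End.hasEigenvector_iff.2
        ⟨Module.End.mem_eigenspace_iff.2 (h.mulVec_colProd i j), h.colProd_ne_zero i j⟩
    have hisRoot := Module.End.isRoot_of_hasEigenvalue
      (Module.End.hasEigenvalue_of_hasEigenvector heigen)
    rw [Matrix.minpoly_toLin'] at hisRoot
    rw [Polynomial.mem_rootSet_of_ne (minpoly.ne_zero (Matrix.isIntegral A))]
    simpa using hisRoot
  calc (Set.range (Function.uncurry B)).ncard ≤ ((minpoly ℂ A).rootSet ℂ).ncard :=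
        Set.ncard_le_ncard (Set.range_subset_iff.2 fun p => hroot p.1 p.2)
    _ ≤ (minpoly ℂ A).natDegree := Polynomial.ncard_rootSet_le _ _
    _ ≤ dimension A B := natDegree_minpoly_le_dimension fun i j => ⟨B i j, h.mulVec_colProd i j⟩

lemma dimension_le_sq : dimension A B ≤ n ^ 2 := by
  simpa [dimension, Module.finrank_matrix, sq] using (nomura A B).finrank_le

lemma IsBraidPair.exists_two_valued [Nontrivial (Fin n)] (h : IsBraidPair A B) (hB : IsUnit B)
    (hdim : dimension A B ≤ 2) : ∃ a b : ℂ, a ≠ b ∧ ∀ i j, B i j = a ∨ B i j = b := by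
  have htwo : (Set.range (Function.uncurry B)).ncard = 2 := by
    refine le_antisymm (h.ncard_range_le_dimension.trans hdim) ?_
    obtain ⟨i, j⟩ : Nonempty (Fin n × Fin n) := inferInstance
    obtain ⟨i', j', hne⟩ := exists_apply_ne_of_isUnit hB (B i j)
    exact (Set.one_lt_ncard).2 ⟨_, ⟨(i', j'), rfl⟩, _, ⟨(i, j), rfl⟩, hne⟩
  obtain ⟨a, b, hab, hrange⟩ := Set.ncard_eq_two.1 htwo
  exact ⟨a, b, hab, fun i j => hrange.subset ⟨(i, j), rfl⟩⟩

end JonesPair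

end JonesPair

theorem mainTheorem10_general (n : ℕ) (A B : Matrix (Fin n) (Fin n) ℂ)
    (hAB : JonesPair.IsOneSidedJonesPair A B) (hB : IsUnit B)
    (hdim : JonesPair.dimension A B = 2) :
    ∃ (k lam : ℕ) (D : JonesPair.SymmetricDesign (Fin n) (Fin n) n k lam) (a b : ℂ),
      B = a • (JonesPair.allOnes n - D.incMatrix) + b • D.incMatrix := by
  have h := hAB.isBraidPair
  have : Nontrivial (Fin n) := by
    rw [Fin.nontrivial_iff_two_le]
    have := hdim ▸ JonesPair.dimension_le_sq (A := A) (B := B)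
    nlinarith
  obtain ⟨a, b, hab, hval⟩ := h.exists_two_valued hB hdim.le
  obtain ⟨k, lam, D, hinc⟩ :=
    (h.isTypeII_right hB).exists_symmetricDesign hval h.sum_col hab (Nat.card_fin n)
  exact ⟨k, lam, D, a, b, D.eq_smul_add_smul_incMatrix hval hinc⟩

theorem mainTheorem10 (n : ℕ) (A B : Matrix (Fin n) (Fin n) ℂ)
    (hAB : JonesPair.IsInvertibleJonesPair A B)
    (hdim : JonesPair.dimension A B = 2) :
    ∃ (k lam : ℕ) (D : JonesPair.SymmetricDesign (Fin n) (Fin n) n k lam) (a b : ℂ),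
      B = a • (JonesPair.allOnes n - D.incMatrix) + b • D.incMatrix :=
  mainTheorem10_general n A B hAB.1.1 hAB.2.2 hdim
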